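/- For integers $a,b,c,d,e,f$ and a rational number $r$ let $$(a,b,c,d,e,f)(r)=\bigl|\{(x,y,z)\in\mathbf Z^3 : r=ax^2+by^2+cz^2+dyz+ezx+fxy\}\bigr|.$$ In particular, for each of the positive diagonal forms below this number is finite, and it is $0$ when $r$ is not an integer. Let $M$ be an integer. (i) If $M\equiv 1 \pmod 8$ and $3\mid M$, then $$3\,(1,8,8,0,0,0)\left(\frac{M}{3^2}\right)=-(1,6,6,0,0,0)(M)+2\,(2,3,6,0,0,0)(M).$$ (ii) If $M\equiv 1$ or $2 \pmod 4$ and $3\mid M$, then $$(1,1,1,0,0,0)\left(\frac{M}{3^2}\right)=-(1,6,6,0,0,0)(M)+2\,(2,3,6,0,0,0)(M).$$ (iii) If $M\equiv 1\pmod 8$, $3\mid M$ and $3^2\nmid M$, then $$(1,6,6,0,0,0)(M)=2\,(2,3,6,0,0,0)(M)\quad\text{and}\quad (1,8,8,0,0,0)(M)=2\,(1,6,6,0,0,0)(M).$$ -/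

import Mathlib

/-- The set of integer triples `(x, y, z)` at which the ternary quadratic form
`a x² + b y² + c z² + d y z + e z x + f x y` takes the value `r`. The value is rational,
so that arguments such as `M / 9` make sense when `9` does not divide `M`. -/
def ternaryRepSet (a b c d e f : ℤ) (r : ℚ) : Set (ℤ × ℤ × ℤ) :=
  {v | r = a * (v.1 : ℚ) ^ 2 + b * (v.2.1 : ℚ) ^ 2 + c * (v.2.2 : ℚ) ^ 2
    + d * (v.2.1 : ℚ) * v.2.2 + e * (v.2.2 : ℚ) * v.1 + f * (v.1 : ℚ) * v.2.1}

/-- The number `(a,b,c,d,e,f)(r)` of representations of `r` by the ternary form. -/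
noncomputable def ternaryRep (a b c d e f : ℤ) (r : ℚ) : ℕ :=
  (ternaryRepSet a b c d e f r).ncard

/-- For positive diagonal forms the representation set is finite, so that `ternaryRep` is its
true cardinality. -/
theorem ternaryRepSet_diag_finite {a b c : ℤ} (ha : 0 < a) (hb : 0 < b) (hc : 0 < c) (r : ℚ) :
    (ternaryRepSet a b c 0 0 0 r).Finite := by
  refine (((Set.finite_Icc (-⌈r⌉) ⌈r⌉).prod ((Set.finite_Icc (-⌈r⌉) ⌈r⌉).prod
    (Set.finite_Icc (-⌈r⌉) ⌈r⌉)))).subset ?_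
  rintro ⟨x, y, z⟩ h
  simp only [ternaryRepSet, Set.mem_ofPred_eq, Int.cast_zero, zero_mul, add_zero] at h
  have h1 : a * x ^ 2 + b * y ^ 2 + c * z ^ 2 ≤ ⌈r⌉ := by
    have h2 := Int.le_ceil r
    have h3 : ((a * x ^ 2 + b * y ^ 2 + c * z ^ 2 : ℤ) : ℚ) ≤ (⌈r⌉ : ℚ) := by
      push_cast
      linarith
    exact_mod_cast h3
  have key : ∀ k t : ℤ, 0 < k → |t| ≤ k * t ^ 2 := by
    intro k t hk
    rw [← sq_abs]
    rcases (abs_nonneg t).eq_or_lt with h0 | h0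
    · rw [← h0]
      simp
    · nlinarith [mul_pos h0 h0, mul_nonneg (sub_nonneg.2 (Int.add_one_le_iff.2 hk)) (sq_nonneg |t|)]
  have hx := key a x ha
  have hy := key b y hb
  have hz := key c z hc
  have hx0 := abs_nonneg x
  have hy0 := abs_nonneg y
  have hz0 := abs_nonneg z
  simp only [Set.mem_prod, Set.mem_Icc]
  refine ⟨abs_le.1 ?_, abs_le.1 ?_, abs_le.1 ?_⟩ <;> linarith

/-!
Write `r[a,b,c](N)` for the number of representations of `N` by the diagonal form. With `M = 3 N`,
after cancelling factors of `3`, statement (ii) becomes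

  `r[3,3,3](N) + r[3,2,2](N) = 2 r[1,2,6](N)` for `N ≡ 2, 3 (mod 4)` (`ternaryRep_relation`).

Statement (i) follows from (ii) and `r[1,1,1](m) = 3 r[1,8,8](m)` for `m ≡ 1 (mod 8)`. In (iii) the
term `r[3,3,3](N)` vanishes, and `r[1,8,8](3 N) = 4 r[1,2,6](N)` by a direct correspondence
(`ternaryRep_one_eight_eight`).

The forms `(3,2,2)` and `(1,2,6)` are not rationally equivalent, so no linear correspondence
between lattice points proves the displayed relation. It is an identity of theta series. Write `a` and `b` for the
sums of `q ^ (n²)` over even and over odd `n`, write `A` and `B` for `a(q³)` and `b(q³)`, and put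
`X = a(q²) b(q⁶) + b(q²) a(q⁶)`. Splitting exponents modulo `4`, the relation becomes the pair

  `A (3 B² + b²) = 2 a X`,   `B (3 A² + a²) = 2 b X`   (`thetaSeries_cubic_relations`).

The proof of this pair rests on three facts about lattices of rank two. Rotating the square
lattice by `45°` expresses `a²`, `b²`, `c²` through `a(q²)`, `b(q²)`, where `c` is the alternating
version of `a` (`thetaSeries_even_sq`, `thetaSeries_odd_sq`, `thetaSeries_sign_sq`). The symmetry of the
hexagonal lattice gives `a A - b B = c C` with `C = c(q³)` (`thetaSeries_even_sub_odd`). The same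
symmetry kills quadratic harmonic polynomials, so that with `D = q d/dq`
`a DA - A Da + b DB - B Db = 0` (`thetaSeries_wronskian`).

The first two facts yield `X² = a A b B` and `(a A - b B)⁴ = (a⁴ - b⁴) (A⁴ - B⁴)`. These determine
`(b A / (a B))²` in terms of `p = X B / (b A²)`, but they are unaffected when `a` and `b` are scaled
together, so they leave `a / A` open. The third fact settles it: `a² / A²` and `1 + 2 p` have the
same logarithmic derivative (`logDeriv_elimination`), and as both have constant term `1` they are
equal. The cubic relations then follow algebraically (`cubic_relations`).
-/

/-! ### Weighted counting series -/

/-- The series `∑ᵢ w i · X ^ f i`. The definition is meaningful when `f` has finite fibres;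
an infinite fibre may contribute a junk coefficient. -/
noncomputable def countingSeries {ι : Type*} (w : ι → ℚ) (f : ι → ℕ) : PowerSeries ℚ :=
  PowerSeries.mk fun n => ∑ᶠ i ∈ {i | f i = n}, w i

/-- An exponent function takes each value finitely often. It is stated with `≤`, which is equivalent
and directly stable under sums of exponents. -/
def FiniteFibres {ι : Type*} (f : ι → ℕ) : Prop := ∀ n, {i | f i ≤ n}.Finite

theorem FiniteFibres.fibre {ι : Type*} {f : ι → ℕ} (hf : FiniteFibres f) (n : ℕ) :
    {i | f i = n}.Finite :=
  (hf n).subset fun _ hi => le_of_eq hi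

theorem FiniteFibres.prod {ι κ : Type*} {f : ι → ℕ} {g : κ → ℕ} (hf : FiniteFibres f)
    (hg : FiniteFibres g) : FiniteFibres fun p : ι × κ => f p.1 + g p.2 := fun n =>
  ((hf n).prod (hg n)).subset fun p (hp : f p.1 + g p.2 ≤ n) =>
    Set.mem_prod.2 ⟨show f p.1 ≤ n by omega, show g p.2 ≤ n by omega⟩

theorem coeff_countingSeries_eq_sum {ι : Type*} (w : ι → ℚ) (f : ι → ℕ) (n : ℕ) (s : Finset ι)
    (hs : ∀ i, f i = n → i ∈ s) :
    PowerSeries.coeff n (countingSeries w f) = ∑ i ∈ s, if f i = n then w i else 0 := by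
  classical
  have h : {i | f i = n} = ((s.filter fun i => f i = n : Finset ι) : Set ι) := by
    ext i
    simp only [Set.mem_ofPred_eq, Finset.coe_filter]
    exact ⟨fun h => ⟨hs i h, h⟩, fun h => h.2⟩
  rw [countingSeries, PowerSeries.coeff_mk, ← Finset.sum_filter, h, finsum_mem_coe_finset]

theorem countingSeries_add {ι : Type*} (w v : ι → ℚ) {f : ι → ℕ} (hf : FiniteFibres f) :
    countingSeries (fun i => w i + v i) f = countingSeries w f + countingSeries v f := by
  ext n
  simp only [countingSeries, PowerSeries.coeff_mk, map_add]
  exact finsum_mem_add_distrib (hf.fibre n)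

theorem countingSeries_smul {ι : Type*} (c : ℚ) (w : ι → ℚ) (f : ι → ℕ) :
    countingSeries (fun i => c * w i) f = PowerSeries.C c * countingSeries w f := by
  ext n
  simp only [countingSeries, PowerSeries.coeff_mk, PowerSeries.coeff_C_mul]
  exact (mul_finsum_mem _ _).symm

theorem countingSeries_mul {ι κ : Type*} (w : ι → ℚ) (v : κ → ℚ) {f : ι → ℕ} {g : κ → ℕ}
    (hf : FiniteFibres f) (hg : FiniteFibres g) :
    countingSeries w f * countingSeries v g =
      countingSeries (fun p : ι × κ => w p.1 * v p.2) (fun p => f p.1 + g p.2) := by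
  classical
  ext n
  rw [PowerSeries.coeff_mul, coeff_countingSeries_eq_sum _ _ n
    ((hf n).toFinset ×ˢ (hg n).toFinset)]
  · have h : ∀ p ∈ Finset.HasAntidiagonal.antidiagonal n,
        PowerSeries.coeff p.1 (countingSeries w f) * PowerSeries.coeff p.2 (countingSeries v g) =
        ∑ i ∈ (hf n).toFinset, ∑ j ∈ (hg n).toFinset,
          if (f i, g j) = p then w i * v j else 0 := by
      intro p hp
      have hp' := Finset.HasAntidiagonal.mem_antidiagonal.1 hp
      rw [coeff_countingSeries_eq_sum w f p.1 (hf n).toFinset,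
        coeff_countingSeries_eq_sum v g p.2 (hg n).toFinset, Finset.sum_mul_sum]
      · refine Finset.sum_congr rfl fun i _ => Finset.sum_congr rfl fun j _ => ?_
        by_cases h1 : f i = p.1 <;> by_cases h2 : g j = p.2 <;> simp [h1, h2, Prod.ext_iff]
      · intro j hj
        simp only [Set.Finite.mem_toFinset, Set.mem_ofPred_eq]
        omega
      · intro i hi
        simp only [Set.Finite.mem_toFinset, Set.mem_ofPred_eq]
        omega
    rw [Finset.sum_congr rfl h, Finset.sum_comm, Finset.sum_product]
    refine Finset.sum_congr rfl fun i _ => ?_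
    rw [Finset.sum_comm]
    refine Finset.sum_congr rfl fun j _ => ?_
    rw [Finset.sum_ite_eq]
    simp [Finset.HasAntidiagonal.mem_antidiagonal]
  · rintro ⟨i, j⟩ hij
    simp only [Finset.mem_product, Set.Finite.mem_toFinset, Set.mem_ofPred_eq] at hij ⊢
    omega

/-- Two counting series agree as soon as mutually inverse partial maps, defined where the weights
do not vanish, match weights and exponents. -/
theorem countingSeries_congr {ι κ : Type*} {w : ι → ℚ} {v : κ → ℚ} {f : ι → ℕ} {g : κ → ℕ}
    (e : ι → κ) (e' : κ → ι)
    (h : ∀ i, w i ≠ 0 → e' (e i) = i ∧ v (e i) = w i ∧ g (e i) = f i)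
    (h' : ∀ j, v j ≠ 0 → e (e' j) = j ∧ w (e' j) = v j ∧ f (e' j) = g j) :
    countingSeries w f = countingSeries v g := by
  ext n
  simp only [countingSeries, PowerSeries.coeff_mk]
  rw [← finsum_mem_inter_support w, ← finsum_mem_inter_support v]
  refine finsum_mem_eq_of_bijOn e ?_ fun i hi => ((h i hi.2).2.1).symm
  refine Set.InvOn.bijOn (f' := e') ⟨fun i hi => (h i hi.2).1, fun j hj => (h' j hj.2).1⟩ ?_ ?_
  · rintro i ⟨hi, hw⟩
    obtain ⟨-, h2, h3⟩ := h i hw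
    exact ⟨h3.trans hi, by rw [Function.mem_support, h2]; exact hw⟩
  · rintro j ⟨hj, hw⟩
    obtain ⟨-, h2, h3⟩ := h' j hw
    exact ⟨h3.trans hj, by rw [Function.mem_support, h2]; exact hw⟩

theorem coeff_countingSeries_one {ι : Type*} {f : ι → ℕ} (hf : FiniteFibres f) (n : ℕ) :
    PowerSeries.coeff n (countingSeries (fun _ => 1) f) = ({i | f i = n}.ncard : ℚ) := by
  rw [countingSeries, PowerSeries.coeff_mk, finsum_mem_eq_finite_toFinset_sum _ (hf.fibre n),
    Set.ncard_eq_toFinset_card _ (hf.fibre n)]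
  simp

/-! ### The Euler operator and leading terms of power series -/

/-- The Euler operator `X · d/dX`. -/
noncomputable def eulerD (f : PowerSeries ℚ) : PowerSeries ℚ :=
  PowerSeries.X * PowerSeries.derivative ℚ f

theorem eulerD_mul (f g : PowerSeries ℚ) : eulerD (f * g) = eulerD f * g + f * eulerD g := by
  simp only [eulerD, Derivation.leibniz, smul_eq_mul]
  ring

theorem eulerD_add (f g : PowerSeries ℚ) : eulerD (f + g) = eulerD f + eulerD g := by
  simp only [eulerD, map_add, mul_add]

theorem eulerD_sub (f g : PowerSeries ℚ) : eulerD (f - g) = eulerD f - eulerD g := by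
  simp only [eulerD, map_sub, mul_sub]

theorem eulerD_two : eulerD 2 = 0 := by
  have h := eulerD_mul 1 1
  rw [one_mul, one_mul, mul_one, left_eq_add] at h
  rw [← one_add_one_eq_two, eulerD_add, h, add_zero]

theorem coeff_eulerD (f : PowerSeries ℚ) (n : ℕ) :
    PowerSeries.coeff n (eulerD f) = n * PowerSeries.coeff n f := by
  cases n with
  | zero => simp [eulerD]
  | succ n =>
    rw [eulerD, PowerSeries.coeff_succ_X_mul, PowerSeries.coeff_derivative]
    push_cast
    ring

theorem eulerD_countingSeries {ι : Type*} (w : ι → ℚ) (f : ι → ℕ) :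
    eulerD (countingSeries w f) = countingSeries (fun i => f i * w i) f := by
  ext n
  rw [coeff_eulerD, countingSeries, countingSeries, PowerSeries.coeff_mk, PowerSeries.coeff_mk,
    mul_finsum_mem]
  exact finsum_mem_congr rfl fun i (hi : f i = n) => by rw [hi]

/-- `f = c X ^ k + O(X ^ (k + 1))`. The coefficient `c` is allowed to vanish. -/
def HasLeadingTerm (k : ℕ) (c : ℚ) (f : PowerSeries ℚ) : Prop :=
  ∃ g, f = PowerSeries.X ^ k * g ∧ PowerSeries.constantCoeff g = c

namespace HasLeadingTerm

variable {k l : ℕ} {c d : ℚ} {f g : PowerSeries ℚ}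

theorem mul (hf : HasLeadingTerm k c f) (hg : HasLeadingTerm l d g) :
    HasLeadingTerm (k + l) (c * d) (f * g) := by
  obtain ⟨f, rfl, rfl⟩ := hf
  obtain ⟨g, rfl, rfl⟩ := hg
  exact ⟨f * g, by ring, by simp⟩

theorem add (hf : HasLeadingTerm k c f) (hg : HasLeadingTerm k d g) :
    HasLeadingTerm k (c + d) (f + g) := by
  obtain ⟨f, rfl, rfl⟩ := hf
  obtain ⟨g, rfl, rfl⟩ := hg
  exact ⟨f + g, by ring, by simp⟩

theorem neg (hf : HasLeadingTerm k c f) : HasLeadingTerm k (-c) (-f) := by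
  obtain ⟨f, rfl, rfl⟩ := hf
  exact ⟨-f, by ring, by simp⟩

theorem zero_of_lt (hf : HasLeadingTerm l d f) (h : k < l) : HasLeadingTerm k 0 f := by
  obtain ⟨f, rfl, rfl⟩ := hf
  obtain ⟨m, rfl⟩ := Nat.exists_eq_add_of_lt h
  exact ⟨PowerSeries.X ^ (m + 1) * f, by ring, by simp⟩

theorem add_of_lt (hf : HasLeadingTerm k c f) (hg : HasLeadingTerm l d g) (h : k < l) :
    HasLeadingTerm k c (f + g) := by
  simpa using hf.add (hg.zero_of_lt h)

theorem two_mul (hf : HasLeadingTerm k c f) : HasLeadingTerm k (2 * c) (2 * f) := by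
  rw [_root_.two_mul, _root_.two_mul]
  exact hf.add hf

theorem unique (hf : HasLeadingTerm k c f) (hg : HasLeadingTerm k d f) : c = d := by
  obtain ⟨f, rfl, rfl⟩ := hf
  obtain ⟨g, hg, rfl⟩ := hg
  rw [mul_left_cancel₀ (pow_ne_zero _ PowerSeries.X_ne_zero) hg]

theorem ne_zero (hf : HasLeadingTerm k c f) (hc : c ≠ 0) : f ≠ 0 := by
  rintro rfl
  exact hc (hf.unique ⟨0, by simp, by simp⟩)

theorem eulerD (hf : HasLeadingTerm k c f) : HasLeadingTerm k (k * c) (eulerD f) := by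
  obtain ⟨f, rfl, rfl⟩ := hf
  refine ⟨k * f + _root_.eulerD f, ?_, by simp [_root_.eulerD]⟩
  rw [eulerD_mul]
  have : _root_.eulerD (PowerSeries.X ^ k) = k * (PowerSeries.X : PowerSeries ℚ) ^ k := by
    ext n
    rw [coeff_eulerD, ← map_natCast (PowerSeries.C (R := ℚ)), PowerSeries.coeff_C_mul,
      PowerSeries.coeff_X_pow]
    split_ifs with h
    · rw [h]
    · simp
  rw [this]
  ring

theorem of_coeff (h : ∀ n < k, PowerSeries.coeff n f = 0) (hk : PowerSeries.coeff k f = c) :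
    HasLeadingTerm k c f := by
  obtain ⟨g, rfl⟩ := PowerSeries.X_pow_dvd_iff.2 h
  exact ⟨g, rfl, by simpa [PowerSeries.coeff_X_pow_mul'] using hk⟩

theorem exists_of_ne_zero (hf : f ≠ 0) : ∃ k c, c ≠ 0 ∧ HasLeadingTerm k c f := by
  classical
  have h : ∃ n, PowerSeries.coeff n f ≠ 0 := by
    by_contra! h
    exact hf (PowerSeries.ext fun n => by simp [h n])
  exact ⟨Nat.find h, _, Nat.find_spec h,
    of_coeff (fun n hn => not_not.1 (Nat.find_min h hn)) rfl⟩

/-- Proportional logarithmic derivatives and equal leading terms force equality. -/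
theorem eq_of_mul_eulerD_eq (hf : HasLeadingTerm k c f) (hg : HasLeadingTerm k c g) (hc : c ≠ 0)
    (h : f * _root_.eulerD g = g * _root_.eulerD f) : f = g := by
  by_contra hne
  obtain ⟨m, d, hd, hm⟩ := exists_of_ne_zero (sub_ne_zero.2 hne)
  have h0 : HasLeadingTerm k 0 (f - g) := by simpa [sub_eq_add_neg] using hf.add hg.neg
  have hmk : m ≠ k := by
    rintro rfl
    exact hd (hm.unique h0)
  have h1 : f * _root_.eulerD (f - g) = (f - g) * _root_.eulerD f := by
    rw [eulerD_sub]
    linear_combination -h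
  have h2 := hf.mul hm.eulerD
  rw [h1] at h2
  have h3 := hm.mul hf.eulerD
  rw [add_comm] at h3
  have h4 := h2.unique h3
  have h5 : (c * d) * ((m : ℚ) - k) = 0 := by linear_combination h4
  rcases mul_eq_zero.1 h5 with h6 | h6
  · exact mul_ne_zero hc hd h6
  · exact hmk (by exact_mod_cast sub_eq_zero.1 h6)

end HasLeadingTerm

/-! ### Theta series in one variable -/

/-- The theta series `∑ₙ w n · X ^ (k n²)`, the sum being over all integers `n`. -/
noncomputable def thetaSeries (w : ℤ → ℚ) (k : ℕ) : PowerSeries ℚ :=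
  countingSeries w fun n => k * n.natAbs ^ 2

/-- Indicator of the even integers. -/
def evenWeight (n : ℤ) : ℚ := if n % 2 = 0 then 1 else 0

/-- Indicator of the odd integers. -/
def oddWeight (n : ℤ) : ℚ := if n % 2 = 1 then 1 else 0

/-- The weight `(-1) ^ (n / 2)` at even `n`, and `0` at odd `n`. -/
def signWeight (n : ℤ) : ℚ := if n % 4 = 0 then 1 else if n % 4 = 2 then -1 else 0

theorem finiteFibres_mul_sq {k : ℕ} (hk : 0 < k) :
    FiniteFibres fun n : ℤ => k * n.natAbs ^ 2 := fun N => by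
  refine (Set.finite_Icc (-(N : ℤ)) N).subset fun n (hn : k * n.natAbs ^ 2 ≤ N) => ?_
  have h : n.natAbs ≤ N := by nlinarith [Nat.zero_le n.natAbs]
  rw [Set.mem_Icc]
  omega

theorem thetaSeries_mul (w v : ℤ → ℚ) {k l : ℕ} (hk : 0 < k) (hl : 0 < l) :
    thetaSeries w k * thetaSeries v l = countingSeries (fun p : ℤ × ℤ => w p.1 * v p.2)
      (fun p => k * p.1.natAbs ^ 2 + l * p.2.natAbs ^ 2) :=
  countingSeries_mul w v (finiteFibres_mul_sq hk) (finiteFibres_mul_sq hl)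

theorem eulerD_thetaSeries (w : ℤ → ℚ) (k : ℕ) :
    eulerD (thetaSeries w k) = countingSeries (fun n : ℤ => k * (n : ℚ) ^ 2 * w n)
      fun n => k * n.natAbs ^ 2 := by
  rw [thetaSeries, eulerD_countingSeries]
  congr 1
  ext n
  push_cast
  rw [Nat.cast_natAbs]
  push_cast
  rw [sq_abs]

theorem thetaSeries_one {k : ℕ} (hk : 0 < k) :
    thetaSeries (fun _ => 1) k = thetaSeries evenWeight k + thetaSeries oddWeight k := by
  rw [thetaSeries, thetaSeries, thetaSeries, ← countingSeries_add _ _ (finiteFibres_mul_sq hk)]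
  congr 1
  ext n
  rcases Int.emod_two_eq_zero_or_one n with h | h <;> simp [evenWeight, oddWeight, h]

theorem thetaSeries_hasLeadingTerm_zero {w : ℤ → ℚ} (hw : w 0 = 1) {k : ℕ} (hk : 0 < k) :
    HasLeadingTerm 0 1 (thetaSeries w k) := by
  refine .of_coeff (by simp) ?_
  rw [thetaSeries, coeff_countingSeries_eq_sum _ _ 0 {0}]
  · simp [hw]
  · intro n hn
    have : n.natAbs = 0 := by
      rcases Nat.mul_eq_zero.1 hn with h | h
      · omega
      · exact pow_eq_zero_iff two_ne_zero |>.1 h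
    simpa using this

theorem thetaSeries_oddWeight_hasLeadingTerm {k : ℕ} (hk : 0 < k) :
    HasLeadingTerm k 2 (thetaSeries oddWeight k) := by
  have key : ∀ n : ℤ, k * n.natAbs ^ 2 ≤ k → n = 0 ∨ n = 1 ∨ n = -1 := by
    intro n hn
    have h1 : n.natAbs ^ 2 ≤ 1 := by
      by_contra! h
      nlinarith
    have h2 : n.natAbs ≤ 1 := by nlinarith
    omega
  refine .of_coeff (fun m hm => ?_) ?_
  · rw [thetaSeries, coeff_countingSeries_eq_sum _ _ m {0, 1, -1}]
    · refine Finset.sum_eq_zero fun n hn => ?_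
      have : n = 0 ∨ n = 1 ∨ n = -1 := by simpa using hn
      rcases this with rfl | rfl | rfl <;> simp [oddWeight, hm.ne']
    · intro n hn
      simpa using key n (hn ▸ hm.le)
  · rw [thetaSeries, coeff_countingSeries_eq_sum _ _ k {0, 1, -1}]
    · simp [oddWeight]
      norm_num
    · intro n hn
      simpa using key n hn.le

/-! ### Quadratic relations from the square lattice -/

theorem finiteFibres_binary {k l : ℕ} (hk : 0 < k) (hl : 0 < l) :
    FiniteFibres fun p : ℤ × ℤ => k * p.1.natAbs ^ 2 + l * p.2.natAbs ^ 2 :=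
  (finiteFibres_mul_sq hk).prod (finiteFibres_mul_sq hl)

theorem natAbs_binary_eq {k l k' l' : ℕ} {x y x' y' : ℤ}
    (h : (k : ℤ) * x ^ 2 + l * y ^ 2 = k' * x' ^ 2 + l' * y' ^ 2) :
    k * x.natAbs ^ 2 + l * y.natAbs ^ 2 = k' * x'.natAbs ^ 2 + l' * y'.natAbs ^ 2 := by
  zify
  simpa only [sq_abs] using h

/-- Rotating the square lattice by `45°`: a weighted sum over pairs `m ≡ n (mod 2)` becomes a
weighted sum over all pairs, with the form scaled by `2`. -/
theorem countingSeries_rotate (k : ℕ) (w v : ℤ × ℤ → ℚ)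
    (hw : ∀ m n, w (m, n) ≠ 0 → (m + n) % 2 = 0)
    (h : ∀ m n, w (m + n, m - n) = v (m, n)) :
    countingSeries w (fun p => k * p.1.natAbs ^ 2 + k * p.2.natAbs ^ 2) =
      countingSeries v (fun p => (k * 2) * p.1.natAbs ^ 2 + (k * 2) * p.2.natAbs ^ 2) := by
  refine countingSeries_congr (fun p => ((p.1 + p.2) / 2, (p.1 - p.2) / 2))
    (fun p => (p.1 + p.2, p.1 - p.2)) ?_ ?_
  · rintro ⟨m, n⟩ hmn
    have h1 := hw m n hmn
    obtain ⟨u, v', rfl, rfl⟩ : ∃ u v, m = u + v ∧ n = u - v :=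
      ⟨(m + n) / 2, (m - n) / 2, by omega, by omega⟩
    have e1 : (u + v' + (u - v')) / 2 = u := by omega
    have e2 : (u + v' - (u - v')) / 2 = v' := by omega
    simp only [e1, e2, h, true_and]
    exact natAbs_binary_eq (by push_cast; ring)
  · rintro ⟨m, n⟩ -
    have e1 : (m + n + (m - n)) / 2 = m := by omega
    have e2 : (m + n - (m - n)) / 2 = n := by omega
    simp only [e1, e2, h, true_and]
    exact natAbs_binary_eq (by push_cast; ring)

theorem thetaSeries_even_sq {k : ℕ} (hk : 0 < k) :
    thetaSeries evenWeight k * thetaSeries evenWeight k =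
      thetaSeries evenWeight (k * 2) * thetaSeries evenWeight (k * 2) +
        thetaSeries oddWeight (k * 2) * thetaSeries oddWeight (k * 2) := by
  have hk2 : 0 < k * 2 := by omega
  simp only [thetaSeries_mul _ _ hk hk, thetaSeries_mul _ _ hk2 hk2]
  rw [← countingSeries_add _ _ (finiteFibres_binary hk2 hk2)]
  refine countingSeries_rotate k _ _ ?_ ?_
  · intro m n
    simp only [evenWeight]
    split_ifs <;> simp
    omega
  · intro m n
    simp only [evenWeight, oddWeight]
    split_ifs <;> first | omega | norm_num

theorem thetaSeries_odd_sq {k : ℕ} (hk : 0 < k) :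
    thetaSeries oddWeight k * thetaSeries oddWeight k =
      2 * (thetaSeries evenWeight (k * 2) * thetaSeries oddWeight (k * 2)) := by
  have hk2 : 0 < k * 2 := by omega
  rw [two_mul]
  nth_rewrite 2 [mul_comm (thetaSeries evenWeight (k * 2))]
  simp only [thetaSeries_mul _ _ hk hk, thetaSeries_mul _ _ hk2 hk2]
  rw [← countingSeries_add _ _ (finiteFibres_binary hk2 hk2)]
  refine countingSeries_rotate k _ _ ?_ ?_
  · intro m n
    simp only [oddWeight]
    split_ifs <;> simp
    omega
  · intro m n
    simp only [evenWeight, oddWeight]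
    split_ifs <;> first | omega | norm_num

theorem thetaSeries_sign_sq {k : ℕ} (hk : 0 < k) :
    thetaSeries signWeight k * thetaSeries signWeight k =
      thetaSeries evenWeight (k * 2) * thetaSeries evenWeight (k * 2) -
        thetaSeries oddWeight (k * 2) * thetaSeries oddWeight (k * 2) := by
  have hk2 : 0 < k * 2 := by omega
  rw [eq_sub_iff_add_eq']
  have hneg : thetaSeries oddWeight (k * 2) * thetaSeries oddWeight (k * 2) =
      -(PowerSeries.C (-1 : ℚ) * countingSeries (fun p : ℤ × ℤ => oddWeight p.1 * oddWeight p.2)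
        (fun p => (k * 2) * p.1.natAbs ^ 2 + (k * 2) * p.2.natAbs ^ 2)) := by
    rw [thetaSeries_mul _ _ hk2 hk2]
    simp
  rw [hneg, ← countingSeries_smul, neg_add_eq_iff_eq_add]
  simp only [thetaSeries_mul _ _ hk hk, thetaSeries_mul _ _ hk2 hk2]
  rw [← countingSeries_add _ _ (finiteFibres_binary hk2 hk2)]
  refine countingSeries_rotate k _ _ ?_ ?_
  · intro m n
    simp only [signWeight]
    split_ifs <;> simp <;> omega
  · intro m n
    simp only [signWeight, evenWeight, oddWeight]
    split_ifs <;> first | omega | norm_num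

/-! ### Relations from the hexagonal lattice -/

/-- In the lattice `m ≡ n (mod 2)` with the form `m² + 3n²`, the reflection
`(m, n) ↦ ((m + 3n) / 2, (m - n) / 2)` interchanges the class of odd pairs with `m ≡ n (mod 4)` and
the class of even pairs with `m + n ≡ 2 (mod 4)`. -/
theorem countingSeries_hexagonal_class :
    countingSeries (fun p : ℤ × ℤ => if p.1 % 2 = 1 ∧ (p.1 - p.2) % 4 = 0 then (1 : ℚ) else 0)
      (fun p => 1 * p.1.natAbs ^ 2 + 3 * p.2.natAbs ^ 2) =
    countingSeries (fun p : ℤ × ℤ => if p.1 % 2 = 0 ∧ (p.1 + p.2) % 4 = 2 then (1 : ℚ) else 0)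
      (fun p => 1 * p.1.natAbs ^ 2 + 3 * p.2.natAbs ^ 2) := by
  refine countingSeries_congr (fun p => ((p.1 + 3 * p.2) / 2, (p.1 - p.2) / 2))
    (fun p => ((p.1 + 3 * p.2) / 2, (p.1 - p.2) / 2)) ?_ ?_
  · rintro ⟨m, n⟩ hmn
    simp only [ne_eq, ite_eq_right_iff, one_ne_zero, imp_false, not_not] at hmn
    obtain ⟨u, rfl⟩ : ∃ u, m = n + 2 * u := ⟨(m - n) / 2, by omega⟩
    have e1 : (n + 2 * u + 3 * n) / 2 = 2 * n + u := by omega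
    have e2 : (n + 2 * u - n) / 2 = u := by omega
    have e3 : (2 * n + u + 3 * u) / 2 = n + 2 * u := by omega
    have e4 : (2 * n + u - u) / 2 = n := by omega
    simp only [e1, e2, e3, e4, true_and]
    refine ⟨?_, natAbs_binary_eq (by push_cast; ring)⟩
    rw [if_pos (by omega), if_pos (by omega)]
  · rintro ⟨m, n⟩ hmn
    simp only [ne_eq, ite_eq_right_iff, one_ne_zero, imp_false, not_not] at hmn
    obtain ⟨u, rfl⟩ : ∃ u, m = n + 2 * u := ⟨(m - n) / 2, by omega⟩
    have e1 : (n + 2 * u + 3 * n) / 2 = 2 * n + u := by omega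
    have e2 : (n + 2 * u - n) / 2 = u := by omega
    have e3 : (2 * n + u + 3 * u) / 2 = n + 2 * u := by omega
    have e4 : (2 * n + u - u) / 2 = n := by omega
    simp only [e1, e2, e3, e4, true_and]
    refine ⟨?_, natAbs_binary_eq (by push_cast; ring)⟩
    rw [if_pos (by omega), if_pos (by omega)]

theorem countingSeries_hexagonal_conj :
    countingSeries (fun p : ℤ × ℤ => if p.1 % 2 = 1 ∧ (p.1 + p.2) % 4 = 0 then (1 : ℚ) else 0)
      (fun p => 1 * p.1.natAbs ^ 2 + 3 * p.2.natAbs ^ 2) =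
    countingSeries (fun p : ℤ × ℤ => if p.1 % 2 = 1 ∧ (p.1 - p.2) % 4 = 0 then (1 : ℚ) else 0)
      (fun p => 1 * p.1.natAbs ^ 2 + 3 * p.2.natAbs ^ 2) := by
  refine countingSeries_congr (fun p => (p.1, -p.2)) (fun p => (p.1, -p.2)) ?_ ?_ <;>
  · rintro ⟨m, n⟩ -
    simp [sub_eq_add_neg]

/-- The degree-three modular equation between theta constants. Among the classes modulo `2` of the
hexagonal lattice, the three nonzero ones contribute equally. -/
theorem thetaSeries_even_sub_odd :
    thetaSeries evenWeight 1 * thetaSeries evenWeight 3 -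
      thetaSeries oddWeight 1 * thetaSeries oddWeight 3 =
    thetaSeries signWeight 1 * thetaSeries signWeight 3 := by
  have hf := finiteFibres_binary one_pos (show 0 < 3 by norm_num)
  have h1 : thetaSeries oddWeight 1 * thetaSeries oddWeight 3 =
      2 * countingSeries
        (fun p : ℤ × ℤ => if p.1 % 2 = 0 ∧ (p.1 + p.2) % 4 = 2 then (1 : ℚ) else 0)
        (fun p => 1 * p.1.natAbs ^ 2 + 3 * p.2.natAbs ^ 2) := by
    rw [two_mul]
    nth_rewrite 1 [← countingSeries_hexagonal_class]
    rw [← countingSeries_hexagonal_class]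
    nth_rewrite 2 [← countingSeries_hexagonal_conj]
    rw [thetaSeries_mul _ _ one_pos (by norm_num), ← countingSeries_add _ _ hf]
    congr 1
    ext ⟨m, n⟩
    simp only [oddWeight]
    split_ifs <;> first | omega | norm_num
  rw [h1, two_mul, sub_eq_iff_eq_add, thetaSeries_mul _ _ one_pos (by norm_num),
    thetaSeries_mul _ _ one_pos (by norm_num), ← countingSeries_add _ _ hf,
    ← countingSeries_add _ _ hf]
  congr 1
  ext ⟨m, n⟩
  simp only [evenWeight, signWeight]
  split_ifs <;> first | omega | norm_num

theorem countingSeries_neg {ι : Type*} (w : ι → ℚ) (f : ι → ℕ) :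
    countingSeries (fun i => -w i) f = -countingSeries w f := by
  have := countingSeries_smul (-1) w f
  simpa using this

/-- Quadratic harmonic polynomials have vanishing sum over each shell of the hexagonal lattice. -/
theorem countingSeries_hexagonal_harmonic :
    countingSeries (fun p : ℤ × ℤ =>
      if (p.1 - p.2) % 2 = 0 then 3 * (p.2 : ℚ) ^ 2 - (p.1 : ℚ) ^ 2 else 0)
      (fun p => 1 * p.1.natAbs ^ 2 + 3 * p.2.natAbs ^ 2) = 0 := by
  have hf := finiteFibres_binary one_pos (show 0 < 3 by norm_num)
  set g : ℤ × ℤ → ℕ := fun p => 1 * p.1.natAbs ^ 2 + 3 * p.2.natAbs ^ 2 with hg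
  set S := countingSeries (fun p : ℤ × ℤ =>
      if (p.1 - p.2) % 2 = 0 then 3 * (p.2 : ℚ) ^ 2 - (p.1 : ℚ) ^ 2 else 0) g with hS
  set T := countingSeries (fun p : ℤ × ℤ =>
      if (p.1 - p.2) % 2 = 0 then 3 * (p.1 : ℚ) * p.2 else 0) g with hT
  have hT0 : T = -T := by
    rw [hT, ← countingSeries_neg]
    refine countingSeries_congr (fun p => (p.1, -p.2)) (fun p => (p.1, -p.2)) ?_ ?_ <;>
    · rintro ⟨m, n⟩ -
      have : (m + n) % 2 = 0 ↔ (m - n) % 2 = 0 := by omega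
      simp [hg, this]
      split_ifs <;> simp
  -- the reflection turns `3n² - m²` into `-(3n² - m²) / 2 - 3mn`
  have hST : S = PowerSeries.C (-1 / 2 : ℚ) * S + -T := by
    rw [hS, ← countingSeries_smul, hT, ← countingSeries_neg,
      ← countingSeries_add _ _ hf]
    refine countingSeries_congr (fun p => ((p.1 + 3 * p.2) / 2, (p.1 - p.2) / 2))
      (fun p => ((p.1 + 3 * p.2) / 2, (p.1 - p.2) / 2)) ?_ ?_
    all_goals
      rintro ⟨m, n⟩ hmn
      have hmn' : (m - n) % 2 = 0 := by
        by_contra hc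
        simp [hc] at hmn
      obtain ⟨u, rfl⟩ : ∃ u, m = n + 2 * u := ⟨(m - n) / 2, by omega⟩
      have e1 : (n + 2 * u + 3 * n) / 2 = 2 * n + u := by omega
      have e2 : (n + 2 * u - n) / 2 = u := by omega
      have e3 : (2 * n + u + 3 * u) / 2 = n + 2 * u := by omega
      have e4 : (2 * n + u - u) / 2 = n := by omega
      have e5 : (2 * n + u - u) % 2 = 0 := by omega
      simp only [e1, e2, e3, e4, e5, hmn', true_and, if_true]
      refine ⟨?_, natAbs_binary_eq (by push_cast; ring)⟩
      push_cast
      ring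
  have hT1 : T = 0 := by
    ext n
    have := congrArg (PowerSeries.coeff n) hT0
    rw [map_neg] at this
    rw [map_zero]
    linarith
  rw [hT1, neg_zero, add_zero] at hST
  ext n
  have := congrArg (PowerSeries.coeff n) hST
  rw [PowerSeries.coeff_C_mul] at this
  rw [map_zero]
  linarith

/-- A differential relation between the theta series at `X` and at `X ^ 3`: the left side sums the
harmonic polynomial `3n² - m²` over the hexagonal lattice. -/
theorem thetaSeries_wronskian :
    thetaSeries evenWeight 1 * eulerD (thetaSeries evenWeight 3) -
      thetaSeries evenWeight 3 * eulerD (thetaSeries evenWeight 1) +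
    thetaSeries oddWeight 1 * eulerD (thetaSeries oddWeight 3) -
      thetaSeries oddWeight 3 * eulerD (thetaSeries oddWeight 1) = 0 := by
  have h1 := finiteFibres_mul_sq one_pos
  have h3 := finiteFibres_mul_sq (show 0 < 3 by norm_num)
  have hf := finiteFibres_binary one_pos (show 0 < 3 by norm_num)
  rw [mul_comm (thetaSeries evenWeight 3), mul_comm (thetaSeries oddWeight 3),
    sub_eq_add_neg, sub_eq_add_neg]
  simp only [eulerD_thetaSeries]
  simp only [thetaSeries]
  rw [countingSeries_mul _ _ h1 h3, countingSeries_mul _ _ h1 h3, countingSeries_mul _ _ h1 h3,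
    countingSeries_mul _ _ h1 h3, ← countingSeries_neg, ← countingSeries_neg,
    ← countingSeries_add _ _ hf, ← countingSeries_add _ _ hf, ← countingSeries_add _ _ hf,
    ← countingSeries_hexagonal_harmonic]
  congr 1
  ext ⟨m, n⟩
  simp only [evenWeight, oddWeight]
  split_ifs <;> first | omega | (push_cast; ring)

/-! ### Elimination -/

/-- Elimination in logarithmic form. The arguments `α β κ l χ` are the logarithmic derivatives of
`a b A B X`. With `p = X B / (b A²)`, the hypotheses say that `p (1 + 2 p) (b A / (a B))² = 2 + p`,
and the conclusion says that `a² / A²` and `1 + 2 p` have the same logarithmic derivative. -/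
theorem logDeriv_elimination {K : Type*} [Field K] {a b A B X α β κ l χ : K}
    (ha : a ≠ 0) (hb : b ≠ 0) (hA : A ≠ 0) (hB : B ≠ 0) (hX : X ≠ 0)
    (hY : b * A ^ 2 + 2 * (X * B) ≠ 0)
    (hQ : (b * A ^ 2) ^ 2 + 4 * (b * A ^ 2) * (X * B) + (X * B) ^ 2 ≠ 0)
    (h1 : X ^ 2 = a * A * b * B)
    (hW : b * X * (b * A ^ 2 + 2 * (X * B)) = a ^ 2 * B * (2 * (b * A ^ 2) + X * B))
    (hW' : b * X * ((β + χ) * (b * A ^ 2 + 2 * (X * B)) +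
        (b * A ^ 2 * (β + 2 * κ) + 2 * (X * B * (χ + l)))) =
      a ^ 2 * B * ((2 * α + l) * (2 * (b * A ^ 2) + X * B) +
        (2 * (b * A ^ 2 * (β + 2 * κ)) + X * B * (χ + l))))
    (h3 : a * A * (κ - α) + b * B * (l - β) = 0) :
    (β + 2 * α) * (b * A ^ 2 + 2 * (X * B)) =
      b * A ^ 2 * (β + 2 * κ) + 2 * (X * B * (χ + l)) := by
  obtain ⟨η, hη⟩ : ∃ η, η = b * A ^ 2 := ⟨_, rfl⟩
  obtain ⟨ξ, hξ⟩ : ∃ ξ, ξ = X * B := ⟨_, rfl⟩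
  have hη0 : η ≠ 0 := by rw [hη]; positivity
  have hξ0 : ξ ≠ 0 := by rw [hξ]; positivity
  simp only [← hη, ← hξ] at hY hQ hW hW' ⊢
  -- `bB / (aA)` in terms of `p`
  have hR : b * B * (η * (η + 2 * ξ)) = a * A * (ξ * (2 * η + ξ)) := by
    have : X * (b * B * (η * (η + 2 * ξ)) - a * A * (ξ * (2 * η + ξ))) = 0 := by
      rw [hη, hξ] at hW ⊢
      linear_combination (b * A ^ 2 * B) * hW - (A * B * (2 * (b * A ^ 2) + X * B)) * a * h1
    exact sub_eq_zero.1 ((mul_eq_zero.1 this).resolve_left hX)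
  have hL : η * (η + 2 * ξ) * (α - κ) + ξ * (2 * η + ξ) * (β - l) = 0 := by
    have : a * A * (η * (η + 2 * ξ) * (α - κ) + ξ * (2 * η + ξ) * (β - l)) = 0 := by
      linear_combination (-(η * (η + 2 * ξ))) * h3 - (β - l) * hR
    exact (mul_eq_zero.1 this).resolve_left (mul_ne_zero ha hA)
  have hWl : (β + χ - 2 * α - l) * (η + 2 * ξ) * (2 * η + ξ) +
      (η * (β + 2 * κ) + 2 * (ξ * (χ + l))) * (2 * η + ξ) -
      (2 * (η * (β + 2 * κ)) + ξ * (χ + l)) * (η + 2 * ξ) = 0 := by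
    have : a ^ 2 * B * ((β + χ - 2 * α - l) * (η + 2 * ξ) * (2 * η + ξ) +
      (η * (β + 2 * κ) + 2 * (ξ * (χ + l))) * (2 * η + ξ) -
      (2 * (η * (β + 2 * κ)) + ξ * (χ + l)) * (η + 2 * ξ)) * (η + 2 * ξ) = 0 := by
      linear_combination (η + 2 * ξ) ^ 2 * hW' - ((η + 2 * ξ) * ((β + χ) * (η + 2 * ξ) +
        (η * (β + 2 * κ) + 2 * (ξ * (χ + l))))) * hW
    exact (mul_eq_zero.1 ((mul_eq_zero.1 this).resolve_right hY)).resolve_left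
      (mul_ne_zero (pow_ne_zero 2 ha) hB)
  have hG : (η ^ 2 + 4 * η * ξ + ξ ^ 2) * ((β + 2 * α) * (η + 2 * ξ) -
      (η * (β + 2 * κ) + 2 * (ξ * (χ + l)))) = 0 := by
    linear_combination 2 * (η + 2 * ξ) * hL - ξ * hWl
  exact sub_eq_zero.1 ((mul_eq_zero.1 hG).resolve_left hQ)

/-- The algebraic step from the quadratic, quartic and differential relations between the theta
constants `a b` and `A B` to the cubic relations. The intermediate identity is
`b a² = b A² + 2 X B`, that is `a² / A² = 1 + 2 p` with `p = X B / (b A²)`. -/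
theorem cubic_relations {a b A B X : PowerSeries ℚ}
    (la : HasLeadingTerm 0 1 a) (lb : HasLeadingTerm 1 2 b) (lA : HasLeadingTerm 0 1 A)
    (lB : HasLeadingTerm 3 2 B) (lX : HasLeadingTerm 2 2 X) (h1 : X ^ 2 = a * A * b * B)
    (h2 : (a * A - b * B) ^ 4 = (a ^ 4 - b ^ 4) * (A ^ 4 - B ^ 4))
    (h3 : a * eulerD A - A * eulerD a + b * eulerD B - B * eulerD b = 0) :
    A * (3 * B ^ 2 + b ^ 2) = 2 * (a * X) ∧ B * (3 * A ^ 2 + a ^ 2) = 2 * (b * X) := by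
  have ha := la.ne_zero one_ne_zero
  have hb := lb.ne_zero two_ne_zero
  have hA := lA.ne_zero one_ne_zero
  have hB := lB.ne_zero two_ne_zero
  have hX := lX.ne_zero two_ne_zero
  -- the sign of the square root is read off from the leading terms
  have hr : b ^ 2 * A ^ 2 - a ^ 2 * B ^ 2 = 2 * ((a * A - b * B) * X) := by
    have hsq : (b ^ 2 * A ^ 2 - a ^ 2 * B ^ 2) ^ 2 = (2 * ((a * A - b * B) * X)) ^ 2 := by
      linear_combination (-4 * (a * A - b * B) ^ 2) * h1 + h2
    refine (sq_eq_sq_iff_eq_or_eq_neg.1 hsq).resolve_right fun hneg => ?_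
    have l1 : HasLeadingTerm 2 4 (b ^ 2 * A ^ 2 - a ^ 2 * B ^ 2) := by
      have e : b ^ 2 * A ^ 2 - a ^ 2 * B ^ 2 = (b * b) * (A * A) + -((a * a) * (B * B)) := by ring
      rw [e]
      have := (((lb.mul lb).mul (lA.mul lA)).add_of_lt ((la.mul la).mul (lB.mul lB)).neg
        (by norm_num))
      norm_num at this
      exact this
    have l2 : HasLeadingTerm 2 (-4) (-(2 * ((a * A - b * B) * X))) := by
      rw [sub_eq_add_neg]
      have := ((((la.mul lA).add_of_lt (lb.mul lB).neg (by norm_num)).mul lX).two_mul).neg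
      norm_num at this
      exact this
    rw [hneg] at l1
    have := l1.unique l2
    norm_num at this
  have hW : b * X * (b * A ^ 2 + 2 * (X * B)) = a ^ 2 * B * (2 * (b * A ^ 2) + X * B) := by
    linear_combination X * hr + 2 * a * A * h1
  have lη : HasLeadingTerm 1 2 (b * A ^ 2) := by
    have := lb.mul (lA.mul lA)
    norm_num [← pow_two] at this
    exact this
  have lξ : HasLeadingTerm 5 4 (X * B) := by
    have := lX.mul lB
    norm_num at this
    exact this
  have lY : HasLeadingTerm 1 2 (b * A ^ 2 + 2 * (X * B)) := lη.add_of_lt lξ.two_mul (by norm_num)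
  have hK : b * a ^ 2 = b * A ^ 2 + 2 * (X * B) := by
    have lZ : HasLeadingTerm 1 2 (b * a ^ 2) := by
      have := lb.mul (la.mul la)
      norm_num [← pow_two] at this
      exact this
    refine lZ.eq_of_mul_eulerD_eq lY two_ne_zero ?_
    have hQ : (b * A ^ 2) ^ 2 + 4 * (b * A ^ 2) * (X * B) + (X * B) ^ 2 ≠ 0 := by
      have l : HasLeadingTerm 2 4
          ((b * A ^ 2) * (b * A ^ 2) + (X * B) * (2 * (2 * (b * A ^ 2)) + X * B)) := by
        have l4 : HasLeadingTerm 1 8 (2 * (2 * (b * A ^ 2)) + X * B) := by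
          have := lη.two_mul.two_mul.add_of_lt lξ (by norm_num)
          norm_num at this
          exact this
        have := (lη.mul lη).add_of_lt (lξ.mul l4) (by norm_num)
        norm_num at this
        exact this
      have e : (b * A ^ 2) ^ 2 + 4 * (b * A ^ 2) * (X * B) + (X * B) ^ 2 =
          (b * A ^ 2) * (b * A ^ 2) + (X * B) * (2 * (2 * (b * A ^ 2)) + X * B) := by ring
      rw [e]
      exact l.ne_zero (by norm_num)
    have hDW := congrArg eulerD hW
    simp only [pow_two, eulerD_mul, eulerD_add, eulerD_two, zero_mul, zero_add] at hDW ⊢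
    -- in the fraction field the logarithmic derivatives are available
    let K := FractionRing (PowerSeries ℚ)
    let φ : PowerSeries ℚ →+* K := algebraMap (PowerSeries ℚ) K
    have hφ : Function.Injective φ := IsFractionRing.injective (PowerSeries ℚ) K
    have hz : ∀ f, f ≠ 0 → φ f ≠ 0 := fun f hf => (map_ne_zero_iff φ hφ).2 hf
    have hlog : ∀ f : PowerSeries ℚ, f ≠ 0 → ∃ γ, φ (eulerD f) = γ * φ f := fun f hf =>
      ⟨φ (eulerD f) / φ f, (div_mul_cancel₀ _ (hz f hf)).symm⟩
    obtain ⟨α, hα⟩ := hlog a ha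
    obtain ⟨β, hβ⟩ := hlog b hb
    obtain ⟨κ, hκ⟩ := hlog A hA
    obtain ⟨l, hl⟩ := hlog B hB
    obtain ⟨χ, hχ⟩ := hlog X hX
    have key := logDeriv_elimination (α := α) (β := β) (κ := κ) (l := l) (χ := χ)
      (hz a ha) (hz b hb) (hz A hA) (hz B hB) (hz X hX)
      (by simpa [map_ofNat] using hz _ (lY.ne_zero two_ne_zero))
      (by simpa [map_ofNat] using hz _ hQ)
      (by simpa using congrArg φ h1) (by simpa [map_ofNat] using congrArg φ hW)
      (by
        have h := congrArg φ hDW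
        simp only [map_mul, map_add, map_ofNat, hα, hβ, hκ, hl, hχ] at h
        linear_combination h)
      (by
        have h := congrArg φ h3
        simp only [map_mul, map_add, map_sub, map_zero, hα, hβ, hκ, hl] at h
        linear_combination h)
    apply hφ
    simp only [map_mul, map_add, map_ofNat, hα, hβ, hκ, hl, hχ]
    linear_combination (-(φ b * φ a ^ 2)) * key
  have hV : b ^ 2 * X = B * (2 * (b * A ^ 2) + X * B) := by
    refine mul_left_cancel₀ (pow_ne_zero 2 ha) ?_
    linear_combination hW + b * X * hK
  constructor
  · refine mul_left_cancel₀ hX ?_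
    linear_combination A * hV - 2 * a * h1 - 2 * A * B * hK
  · refine mul_left_cancel₀ hb ?_
    linear_combination B * hK - 2 * hV

/-! ### Dissection modulo four -/

/-- All exponents of the series lie in the residue class `r` modulo `4`. -/
def SupportedMod (r : ZMod 4) (f : PowerSeries ℚ) : Prop :=
  ∀ n : ℕ, PowerSeries.coeff n f ≠ 0 → (n : ZMod 4) = r

namespace SupportedMod

variable {r s : ZMod 4} {f g : PowerSeries ℚ}

theorem mul (hf : SupportedMod r f) (hg : SupportedMod s g) : SupportedMod (r + s) (f * g) := by
  intro n hn
  rw [PowerSeries.coeff_mul] at hn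
  obtain ⟨p, hp, hne⟩ := Finset.exists_ne_zero_of_sum_ne_zero hn
  rw [← Finset.HasAntidiagonal.mem_antidiagonal.1 hp, Nat.cast_add, hf _ (left_ne_zero_of_mul hne),
    hg _ (right_ne_zero_of_mul hne)]

theorem coeff_eq_zero (hf : SupportedMod r f) {n : ℕ} (hn : (n : ZMod 4) ≠ r) :
    PowerSeries.coeff n f = 0 := by
  by_contra h
  exact hn (hf n h)

end SupportedMod

theorem thetaSeries_supportedMod {w : ℤ → ℚ} {k : ℕ} {r : ZMod 4}
    (h : ∀ n : ℤ, w n ≠ 0 → (k : ZMod 4) * (n : ZMod 4) ^ 2 = r) :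
    SupportedMod r (thetaSeries w k) := by
  intro m hm
  rw [thetaSeries, countingSeries, PowerSeries.coeff_mk] at hm
  obtain ⟨n, hn, hw⟩ := exists_ne_zero_of_finsum_mem_ne_zero hm
  have hn' : k * n.natAbs ^ 2 = m := hn
  rw [← hn', ← h n hw]
  have : ((n.natAbs ^ 2 : ℕ) : ZMod 4) = ((n ^ 2 : ℤ) : ZMod 4) := by
    rw [← Int.natAbs_sq, ← Nat.cast_pow, Int.cast_natCast]
  rw [Nat.cast_mul, this]
  push_cast
  rfl

theorem thetaSeries_even_supportedMod (k : ℕ) : SupportedMod 0 (thetaSeries evenWeight k) := by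
  refine thetaSeries_supportedMod fun n hn => ?_
  have h : n % 2 = 0 := by
    by_contra h
    simp [evenWeight, h] at hn
  obtain ⟨m, rfl⟩ : ∃ m, n = 2 * m := ⟨n / 2, by omega⟩
  push_cast
  have h4 : (4 : ZMod 4) = 0 := by decide
  linear_combination (k : ZMod 4) * (m : ZMod 4) ^ 2 * h4

theorem thetaSeries_odd_supportedMod (k : ℕ) :
    SupportedMod (k : ZMod 4) (thetaSeries oddWeight k) := by
  refine thetaSeries_supportedMod fun n hn => ?_
  have h : n % 2 = 1 := by
    by_contra h
    simp [oddWeight, h] at hn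
  obtain ⟨m, rfl⟩ : ∃ m, n = 2 * m + 1 := ⟨n / 2, by omega⟩
  push_cast
  have h4 : (4 : ZMod 4) = 0 := by decide
  linear_combination (k : ZMod 4) * ((m : ZMod 4) ^ 2 + m) * h4

/-- The cubic relations for the theta constants of level three. -/
theorem thetaSeries_cubic_relations :
    thetaSeries evenWeight 3 * (3 * thetaSeries oddWeight 3 ^ 2 + thetaSeries oddWeight 1 ^ 2) =
      2 * (thetaSeries evenWeight 1 * (thetaSeries evenWeight 2 * thetaSeries oddWeight 6 +
        thetaSeries oddWeight 2 * thetaSeries evenWeight 6)) ∧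
    thetaSeries oddWeight 3 * (3 * thetaSeries evenWeight 3 ^ 2 + thetaSeries evenWeight 1 ^ 2) =
      2 * (thetaSeries oddWeight 1 * (thetaSeries evenWeight 2 * thetaSeries oddWeight 6 +
        thetaSeries oddWeight 2 * thetaSeries evenWeight 6)) := by
  have h3 : 0 < 3 := by norm_num
  have e1 := thetaSeries_even_sq one_pos
  have o1 := thetaSeries_odd_sq one_pos
  have s1 := thetaSeries_sign_sq one_pos
  have e3 := thetaSeries_even_sq h3
  have o3 := thetaSeries_odd_sq h3
  have s3 := thetaSeries_sign_sq h3
  norm_num at e1 o1 s1 e3 o3 s3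
  have hx := thetaSeries_even_sub_odd
  have le {k : ℕ} (hk : 0 < k) := thetaSeries_hasLeadingTerm_zero (w := evenWeight)
    (by simp [evenWeight]) hk
  have lo {k : ℕ} (hk : 0 < k) := thetaSeries_oddWeight_hasLeadingTerm hk
  have lX : HasLeadingTerm 2 2 (thetaSeries evenWeight 2 * thetaSeries oddWeight 6 +
      thetaSeries oddWeight 2 * thetaSeries evenWeight 6) := by
    have := ((lo two_pos).mul (le (k := 6) (by norm_num))).add_of_lt
      ((le two_pos).mul (lo (k := 6) (by norm_num))) (by norm_num)
    norm_num at this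
    rwa [add_comm] at this
  refine cubic_relations (le one_pos) (lo one_pos) (le h3) (lo h3) lX ?_ ?_ thetaSeries_wronskian
  all_goals
    generalize thetaSeries evenWeight 1 = a at *
    generalize thetaSeries evenWeight 2 = a2 at *
    generalize thetaSeries evenWeight 3 = A at *
    generalize thetaSeries evenWeight 6 = A6 at *
    generalize thetaSeries oddWeight 1 = b at *
    generalize thetaSeries oddWeight 2 = b2 at *
    generalize thetaSeries oddWeight 3 = B at *
    generalize thetaSeries oddWeight 6 = B6 at *
    generalize thetaSeries signWeight 1 = c at *
    generalize thetaSeries signWeight 3 = C at *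
  · have hcC : (a * A - b * B) ^ 2 = (a2 * a2 - b2 * b2) * (A6 * A6 - B6 * B6) := by
      rw [hx, ← s1, ← s3]
      ring
    have h2 : 2 * ((a2 * B6 + b2 * A6) ^ 2) = 2 * (a * A * b * B) := by
      linear_combination hcC + (-(A * A)) * e1 - (a2 * a2 + b2 * b2) * e3 - (B * B) * o1 -
        2 * a2 * b2 * o3
    have h20 : (2 : PowerSeries ℚ) ≠ 0 := by
      have := HasLeadingTerm.ne_zero (k := 0) (c := 2) (f := (2 : PowerSeries ℚ))
        ⟨2, by simp, by simp [map_ofNat]⟩ two_ne_zero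
      exact this
    exact mul_left_cancel₀ h20 h2
  · have f1 : a ^ 4 - b ^ 4 = c ^ 4 := by
      have : c ^ 4 = (c * c) ^ 2 := by ring
      rw [this, s1]
      have : a ^ 4 - b ^ 4 = (a * a) ^ 2 - (b * b) ^ 2 := by ring
      rw [this, e1, o1]
      ring
    have f3 : A ^ 4 - B ^ 4 = C ^ 4 := by
      have : C ^ 4 = (C * C) ^ 2 := by ring
      rw [this, s3]
      have : A ^ 4 - B ^ 4 = (A * A) ^ 2 - (B * B) ^ 2 := by ring
      rw [this, e3, o3]
      ring
    rw [f1, f3, hx]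
    ring

/-- The generating function of a diagonal ternary form is a product of theta series. -/
theorem coeff_thetaSeries_mul_mul {a b c : ℕ} (ha : 0 < a) (hb : 0 < b) (hc : 0 < c) (n : ℕ) :
    PowerSeries.coeff n (thetaSeries (fun _ => 1) a *
      (thetaSeries (fun _ => 1) b * thetaSeries (fun _ => 1) c)) =
    (ternaryRep a b c 0 0 0 n : ℚ) := by
  have hbc := finiteFibres_binary hb hc
  have h := coeff_countingSeries_one ((finiteFibres_mul_sq ha).prod hbc) n
  rw [thetaSeries_mul _ _ hb hc, thetaSeries, countingSeries_mul _ _ (finiteFibres_mul_sq ha) hbc]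
  simp only [one_mul]
  rw [h, ternaryRep]
  congr 2
  ext ⟨x, y, z⟩
  simp only [ternaryRepSet, Set.mem_ofPred_eq]
  rw [eq_comm, ← Nat.cast_inj (R := ℚ)]
  push_cast
  simp only [Nat.cast_natAbs, Int.cast_abs, sq_abs]
  ring_nf

/-- The relation between the three diagonal ternary forms `(3,3,3)`, `(3,2,2)`, `(1,2,6)`. -/
theorem ternaryRep_relation {n : ℕ} (hn : n % 4 = 2 ∨ n % 4 = 3) :
    ternaryRep 3 3 3 0 0 0 n + ternaryRep 3 2 2 0 0 0 n = 2 * ternaryRep 1 2 6 0 0 0 n := by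
  have h333 := coeff_thetaSeries_mul_mul (a := 3) (b := 3) (c := 3)
    (by norm_num) (by norm_num) (by norm_num) n
  have h322 := coeff_thetaSeries_mul_mul (a := 3) (b := 2) (c := 2)
    (by norm_num) (by norm_num) (by norm_num) n
  have h126 := coeff_thetaSeries_mul_mul (a := 1) (b := 2) (c := 6)
    (by norm_num) (by norm_num) (by norm_num) n
  simp only [Nat.cast_ofNat, Nat.cast_one] at h333 h322 h126
  suffices h : (ternaryRep 3 3 3 0 0 0 n : ℚ) + ternaryRep 3 2 2 0 0 0 n =
      2 * ternaryRep 1 2 6 0 0 0 n by exact_mod_cast h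
  obtain ⟨r1, r2⟩ := thetaSeries_cubic_relations
  have e1 := thetaSeries_even_sq one_pos
  have o1 := thetaSeries_odd_sq one_pos
  norm_num at e1 o1
  rw [← h333, ← h322, ← h126, thetaSeries_one one_pos, thetaSeries_one two_pos,
    thetaSeries_one (show 0 < 3 by norm_num), thetaSeries_one (show 0 < 6 by norm_num)]
  have a1 := thetaSeries_even_supportedMod 1
  have a2 := thetaSeries_even_supportedMod 2
  have a3 := thetaSeries_even_supportedMod 3
  have a6 := thetaSeries_even_supportedMod 6
  have b1 := thetaSeries_odd_supportedMod 1
  have b2 := thetaSeries_odd_supportedMod 2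
  have b3 := thetaSeries_odd_supportedMod 3
  have b6 := thetaSeries_odd_supportedMod 6
  generalize thetaSeries evenWeight 1 = a at *
  generalize thetaSeries evenWeight 2 = α at *
  generalize thetaSeries evenWeight 3 = A at *
  generalize thetaSeries evenWeight 6 = γ at *
  generalize thetaSeries oddWeight 1 = b at *
  generalize thetaSeries oddWeight 2 = β at *
  generalize thetaSeries oddWeight 3 = B at *
  generalize thetaSeries oddWeight 6 = δ at *
  -- after the cubic relations, only the residue classes `0` and `1` modulo `4` survive
  have key : (A + B) * ((A + B) * (A + B)) + (A + B) * ((α + β) * (α + β)) -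
      PowerSeries.C 2 * ((a + b) * ((α + β) * (γ + δ))) =
      (A * (A * A) + A * (α * α) + A * (β * β) - PowerSeries.C 2 * (a * (α * γ)) -
        PowerSeries.C 2 * (a * (β * δ))) +
      (B * (B * B) + PowerSeries.C 2 * (B * (α * β)) - PowerSeries.C 2 * (b * (α * γ)) -
        PowerSeries.C 2 * (b * (β * δ))) := by
    have h2 : (PowerSeries.C 2 : PowerSeries ℚ) = 2 := map_ofNat _ 2
    rw [h2]
    linear_combination r1 + r2 - A * o1 - B * e1
  have z : ∀ {r : ZMod 4} {f : PowerSeries ℚ}, SupportedMod r f → (r = 0 ∨ r = 1) →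
      PowerSeries.coeff n f = 0 := by
    intro r f hf hr
    refine hf.coeff_eq_zero fun h => ?_
    have hmod : (n : ZMod 4) = ((n % 4 : ℕ) : ZMod 4) := by simp
    rw [hmod] at h
    rcases hn with h' | h' <;> rw [h'] at h <;> rcases hr with rfl | rfl <;> revert h <;> decide
  have hc := congrArg (PowerSeries.coeff n) key
  simp only [map_add, map_sub, PowerSeries.coeff_C_mul] at hc
  rw [z (a3.mul (a3.mul a3)) (by decide), z (a3.mul (a2.mul a2)) (by decide),
    z (a3.mul (b2.mul b2)) (by decide), z (a1.mul (a2.mul a6)) (by decide),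
    z (a1.mul (b2.mul b6)) (by decide), z (b3.mul (b3.mul b3)) (by decide),
    z (b3.mul (a2.mul b2)) (by decide), z (b1.mul (a2.mul a6)) (by decide),
    z (b1.mul (b2.mul b6)) (by decide)] at hc
  linarith

/-! ### Correspondences between representations -/

theorem ncard_eq_of_inverse {α β : Type*} {s : Set α} {t : Set β} (e : α → β) (e' : β → α)
    (h : ∀ x ∈ s, e x ∈ t ∧ e' (e x) = x) (h' : ∀ y ∈ t, e' y ∈ s ∧ e (e' y) = y) :
    s.ncard = t.ncard := by
  have hb : Set.BijOn e s t := Set.InvOn.bijOn (f' := e')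
    ⟨fun x hx => (h x hx).2, fun y hy => (h' y hy).2⟩ (fun x hx => (h x hx).1)
    (fun y hy => (h' y hy).1)
  rw [← hb.image_eq, hb.injOn.ncard_image]

theorem mem_ternaryRepSet_intCast {a b c m x y z : ℤ} :
    (x, y, z) ∈ ternaryRepSet a b c 0 0 0 (m : ℚ) ↔ a * x ^ 2 + b * y ^ 2 + c * z ^ 2 = m := by
  simp only [ternaryRepSet, Set.mem_ofPred_eq, Int.cast_zero, zero_mul, add_zero]
  rw [eq_comm]
  exact_mod_cast Iff.rfl

theorem mem_ternaryRepSet_div_nine {a b c m x y z : ℤ} :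
    (x, y, z) ∈ ternaryRepSet a b c 0 0 0 ((m : ℚ) / 3 ^ 2) ↔
      9 * (a * x ^ 2 + b * y ^ 2 + c * z ^ 2) = m := by
  simp only [ternaryRepSet, Set.mem_ofPred_eq, Int.cast_zero, zero_mul, add_zero]
  rw [eq_comm, eq_div_iff (by norm_num), mul_comm]
  norm_num
  exact_mod_cast Iff.rfl

theorem ternaryRep_of_neg {a b c m : ℤ} (ha : 0 < a) (hb : 0 < b) (hc : 0 < c) (hm : m < 0) :
    ternaryRep a b c 0 0 0 (m : ℚ) = 0 := by
  rw [ternaryRep, Set.ncard_eq_zero (ternaryRepSet_diag_finite ha hb hc _),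
    Set.eq_empty_iff_forall_notMem]
  rintro ⟨x, y, z⟩ h
  rw [mem_ternaryRepSet_intCast] at h
  have : 0 ≤ a * x ^ 2 + b * y ^ 2 + c * z ^ 2 := by positivity
  omega

theorem ternaryRep_relation_int {N : ℤ} (hN : N % 4 = 2 ∨ N % 4 = 3) :
    ternaryRep 3 3 3 0 0 0 N + ternaryRep 3 2 2 0 0 0 N = 2 * ternaryRep 1 2 6 0 0 0 N := by
  rcases lt_or_ge N 0 with h | h
  · rw [ternaryRep_of_neg, ternaryRep_of_neg, ternaryRep_of_neg] <;> first | exact h | norm_num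
  · obtain ⟨n, rfl⟩ := Int.eq_ofNat_of_zero_le h
    exact ternaryRep_relation (by omega)

theorem sq_emod_eight_cases (x : ℤ) :
    (x % 2 = 1 ∧ x ^ 2 % 8 = 1) ∨ (x % 4 = 0 ∧ x ^ 2 % 8 = 0) ∨ (x % 4 = 2 ∧ x ^ 2 % 8 = 4) := by
  have h : x % 8 = 0 ∨ x % 8 = 1 ∨ x % 8 = 2 ∨ x % 8 = 3 ∨ x % 8 = 4 ∨ x % 8 = 5 ∨ x % 8 = 6 ∨
    x % 8 = 7 := by omega
  rcases h with h | h | h | h | h | h | h | h <;> simp [pow_two, Int.mul_emod, h] <;> omega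

theorem three_dvd_of_three_dvd_sq {x : ℤ} (h : 3 ∣ x ^ 2) : 3 ∣ x :=
  Int.prime_three.dvd_of_dvd_pow h

theorem ternaryRep_one_six_six (N : ℤ) :
    ternaryRep 1 6 6 0 0 0 ((3 * N : ℤ) : ℚ) = ternaryRep 3 2 2 0 0 0 N := by
  refine ncard_eq_of_inverse (fun v => (v.1 / 3, v.2)) (fun v => (3 * v.1, v.2)) ?_ ?_
  · rintro ⟨x, y, z⟩ h
    rw [mem_ternaryRepSet_intCast] at h
    obtain ⟨u, rfl⟩ : 3 ∣ x := three_dvd_of_three_dvd_sq (by omega)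
    have e : 3 * u / 3 = u := by omega
    simp only [e, and_true, mem_ternaryRepSet_intCast]
    linarith
  · rintro ⟨x, y, z⟩ h
    rw [mem_ternaryRepSet_intCast] at h
    have e : 3 * x / 3 = x := by omega
    simp only [e, and_true, mem_ternaryRepSet_intCast]
    linarith

theorem ternaryRep_two_three_six (N : ℤ) :
    ternaryRep 2 3 6 0 0 0 ((3 * N : ℤ) : ℚ) = ternaryRep 1 2 6 0 0 0 N := by
  refine ncard_eq_of_inverse (fun v => (v.2.1, v.2.2, v.1 / 3))
    (fun v => (3 * v.2.2, v.1, v.2.1)) ?_ ?_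
  · rintro ⟨x, y, z⟩ h
    rw [mem_ternaryRepSet_intCast] at h
    obtain ⟨u, rfl⟩ : 3 ∣ x := three_dvd_of_three_dvd_sq (by omega)
    have e : 3 * u / 3 = u := by omega
    simp only [e, and_true, mem_ternaryRepSet_intCast]
    linarith
  · rintro ⟨x, y, z⟩ h
    rw [mem_ternaryRepSet_intCast] at h
    have e : 3 * z / 3 = z := by omega
    simp only [e, and_true, mem_ternaryRepSet_intCast]
    linarith

theorem ternaryRep_one_one_one_div_nine (N : ℤ) :
    ternaryRep 1 1 1 0 0 0 (((3 * N : ℤ) : ℚ) / 3 ^ 2) = ternaryRep 3 3 3 0 0 0 N := by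
  rw [ternaryRep, ternaryRep]
  congr 1
  ext ⟨x, y, z⟩
  rw [mem_ternaryRepSet_div_nine, mem_ternaryRepSet_intCast]
  constructor <;> intro h <;> linarith

/-- If a sum of three squares is `1` modulo `8`, exactly one of them is odd; halving the other two
and rotating by `45°` leads to the form `(1, 8, 8)`. -/
theorem ternaryRep_one_one_one {m : ℤ} (hm : m % 8 = 1) :
    ternaryRep 1 1 1 0 0 0 m = 3 * ternaryRep 1 8 8 0 0 0 m := by
  set S := ternaryRepSet 1 1 1 0 0 0 (m : ℚ) with hS
  have hfin : S.Finite := ternaryRepSet_diag_finite one_pos one_pos one_pos _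
  have parity : ∀ x y z : ℤ, (x, y, z) ∈ S →
      (x % 2 = 1 ∧ y % 2 = 0 ∧ (y + z) % 4 = 0) ∨ (y % 2 = 1 ∧ x % 2 = 0 ∧ (x + z) % 4 = 0) ∨
      (z % 2 = 1 ∧ x % 2 = 0 ∧ (x + y) % 4 = 0) := by
    intro x y z h
    rw [hS, mem_ternaryRepSet_intCast] at h
    have hx := sq_emod_eight_cases x
    have hy := sq_emod_eight_cases y
    have hz := sq_emod_eight_cases z
    generalize x ^ 2 = X at *
    generalize y ^ 2 = Y at *
    generalize z ^ 2 = Z at *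
    rcases hx with hx | hx | hx <;> rcases hy with hy | hy | hy <;>
      rcases hz with hz | hz | hz <;> omega
  have hx : (S ∩ {v | v.1 % 2 = 1}).ncard = ternaryRep 1 8 8 0 0 0 m := by
    refine ncard_eq_of_inverse (fun v => (v.1, (v.2.1 + v.2.2) / 4, (v.2.1 - v.2.2) / 4))
      (fun v => (v.1, 2 * (v.2.1 + v.2.2), 2 * (v.2.1 - v.2.2))) ?_ ?_
    · rintro ⟨x, y, z⟩ ⟨h, h1⟩
      replace h1 : x % 2 = 1 := h1
      have hp := parity x y z h
      rw [hS, mem_ternaryRepSet_intCast] at h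
      obtain ⟨u, v, rfl, rfl⟩ : ∃ u v, y = 2 * (u + v) ∧ z = 2 * (u - v) :=
        ⟨(y + z) / 4, (y - z) / 4, by omega, by omega⟩
      have e1 : (2 * (u + v) + 2 * (u - v)) / 4 = u := by omega
      have e2 : (2 * (u + v) - 2 * (u - v)) / 4 = v := by omega
      simp only [e1, e2, and_true, mem_ternaryRepSet_intCast]
      linarith
    · rintro ⟨x, u, v⟩ h
      rw [mem_ternaryRepSet_intCast] at h
      have e1 : (2 * (u + v) + 2 * (u - v)) / 4 = u := by omega
      have e2 : (2 * (u + v) - 2 * (u - v)) / 4 = v := by omega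
      simp only [e1, e2, and_true]
      refine ⟨?_, ?_⟩
      · rw [hS, mem_ternaryRepSet_intCast]
        linarith
      · have := sq_emod_eight_cases x
        change x % 2 = 1
        omega
  have hy : (S ∩ {v | v.2.1 % 2 = 1}).ncard = (S ∩ {v | v.1 % 2 = 1}).ncard := by
    refine ncard_eq_of_inverse (fun v => (v.2.1, v.1, v.2.2)) (fun v => (v.2.1, v.1, v.2.2)) ?_ ?_
    all_goals
      rintro ⟨x, y, z⟩ ⟨h, h1⟩
      rw [hS, mem_ternaryRepSet_intCast] at h
      refine ⟨⟨?_, h1⟩, rfl⟩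
      rw [hS, mem_ternaryRepSet_intCast]
      linarith
  have hz : (S ∩ {v | v.2.2 % 2 = 1}).ncard = (S ∩ {v | v.1 % 2 = 1}).ncard := by
    refine ncard_eq_of_inverse (fun v => (v.2.2, v.2.1, v.1)) (fun v => (v.2.2, v.2.1, v.1)) ?_ ?_
    all_goals
      rintro ⟨x, y, z⟩ ⟨h, h1⟩
      rw [hS, mem_ternaryRepSet_intCast] at h
      refine ⟨⟨?_, h1⟩, rfl⟩
      rw [hS, mem_ternaryRepSet_intCast]
      linarith
  have hu : S = (S ∩ {v | v.1 % 2 = 1}) ∪ ((S ∩ {v | v.2.1 % 2 = 1}) ∪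
      (S ∩ {v | v.2.2 % 2 = 1})) := by
    ext ⟨x, y, z⟩
    simp only [Set.mem_union, Set.mem_inter_iff, Set.mem_ofPred_eq]
    constructor
    · intro h
      have := parity x y z h
      tauto
    · tauto
  rw [ternaryRep, ← hS, hu, Set.ncard_union_eq ?_ (hfin.inter_of_left _)
    ((hfin.inter_of_left _).union (hfin.inter_of_left _)),
    Set.ncard_union_eq ?_ (hfin.inter_of_left _) (hfin.inter_of_left _), hy, hz, hx]
  · ring
  · rw [Set.disjoint_left]
    rintro ⟨x, y, z⟩ ⟨h, h1⟩ ⟨-, h2⟩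
    replace h1 : y % 2 = 1 := h1
    replace h2 : z % 2 = 1 := h2
    have := parity x y z h
    omega
  · rw [Set.disjoint_left]
    rintro ⟨x, y, z⟩ ⟨h, h1⟩ h2
    replace h1 : x % 2 = 1 := h1
    replace h2 : y % 2 = 1 ∨ z % 2 = 1 := by
      rcases h2 with h2 | h2
      · exact Or.inl h2.2
      · exact Or.inr h2.2
    have := parity x y z h
    omega

theorem sq_emod_three_cases (x : ℤ) :
    (x % 3 = 0 ∧ x ^ 2 % 3 = 0) ∨ ((x % 3 = 1 ∨ x % 3 = 2) ∧ x ^ 2 % 3 = 1) := by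
  have h : x % 3 = 0 ∨ x % 3 = 1 ∨ x % 3 = 2 := by omega
  rcases h with h | h | h <;> simp [pow_two, Int.mul_emod, h]

/-- The representations of `3 N` by `(1, 8, 8)` fall into four classes according to the
coordinate divisible by `3` and to the sign relating the other two modulo `3`. Each class
corresponds to the representations of `N` by `(1, 2, 6)`. -/
theorem ternaryRep_one_eight_eight {N : ℤ} (h8 : N % 8 = 3) (h3 : N % 3 ≠ 0) :
    ternaryRep 1 8 8 0 0 0 ((3 * N : ℤ) : ℚ) = 4 * ternaryRep 1 2 6 0 0 0 N := by
  set S := ternaryRepSet 1 8 8 0 0 0 ((3 * N : ℤ) : ℚ) with hS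
  have hfin : S.Finite := ternaryRepSet_diag_finite one_pos (by norm_num) (by norm_num) _
  have hmod : ∀ x y z : ℤ, (x, y, z) ∈ S → x % 3 ≠ 0 ∧
      ((z % 3 = 0 ∧ y % 3 ≠ 0) ∨ (y % 3 = 0 ∧ z % 3 ≠ 0)) := by
    intro x y z h
    rw [hS, mem_ternaryRepSet_intCast] at h
    have hx := sq_emod_three_cases x
    have hy := sq_emod_three_cases y
    have hz := sq_emod_three_cases z
    have h9 : ¬ (x % 3 = 0 ∧ y % 3 = 0 ∧ z % 3 = 0) := by
      rintro ⟨a, b, c⟩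
      obtain ⟨x, rfl⟩ := Int.dvd_of_emod_eq_zero a
      obtain ⟨y, rfl⟩ := Int.dvd_of_emod_eq_zero b
      obtain ⟨z, rfl⟩ := Int.dvd_of_emod_eq_zero c
      have : N = 3 * (x ^ 2 + 8 * y ^ 2 + 8 * z ^ 2) := by linarith
      omega
    generalize x ^ 2 = X at *
    generalize y ^ 2 = Y at *
    generalize z ^ 2 = Z at *
    omega
  have h1 : (S ∩ {v | v.2.2 % 3 = 0 ∧ (v.1 - v.2.1) % 3 = 0}).ncard =
      ternaryRep 1 2 6 0 0 0 N := by
    refine ncard_eq_of_inverse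
      (fun v => ((4 * v.2.1 - v.1) / 3, (v.1 + 2 * v.2.1) / 3, 2 * v.2.2 / 3))
      (fun v => (2 * v.2.1 - v.1, (v.2.1 + v.1) / 2, 3 * v.2.2 / 2)) ?_ ?_
    · rintro ⟨x, y, z⟩ ⟨h, hz, hxy⟩
      replace hz : z % 3 = 0 := hz
      replace hxy : (x - y) % 3 = 0 := hxy
      rw [hS, mem_ternaryRepSet_intCast] at h
      obtain ⟨w, rfl⟩ := Int.dvd_of_emod_eq_zero hz
      obtain ⟨k, rfl⟩ : ∃ k, x = y + 3 * k := ⟨(x - y) / 3, by omega⟩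
      have e1 : (4 * y - (y + 3 * k)) / 3 = y - k := by omega
      have e2 : (y + 3 * k + 2 * y) / 3 = y + k := by omega
      have e3 : 2 * (3 * w) / 3 = 2 * w := by omega
      have e4 : 2 * (y + k) - (y - k) = y + 3 * k := by ring
      have e5 : (y + k + (y - k)) / 2 = y := by omega
      have e6 : 3 * (2 * w) / 2 = 3 * w := by omega
      simp only [e1, e2, e3, e4, e5, e6, and_true, mem_ternaryRepSet_intCast]
      linarith
    · rintro ⟨d, s, w⟩ h
      rw [mem_ternaryRepSet_intCast] at h
      have hp : d % 2 = 1 ∧ s % 2 = 1 ∧ w % 2 = 0 := by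
        have hd := sq_emod_eight_cases d
        have hs := sq_emod_eight_cases s
        have hw := sq_emod_eight_cases w
        generalize d ^ 2 = D at *
        generalize s ^ 2 = T at *
        generalize w ^ 2 = W at *
        rcases hd with hd | hd | hd <;> rcases hs with hs | hs | hs <;>
          rcases hw with hw | hw | hw <;> omega
      obtain ⟨w, rfl⟩ := Int.dvd_of_emod_eq_zero hp.2.2
      obtain ⟨y, k, rfl, rfl⟩ : ∃ y k, d = y - k ∧ s = y + k :=
        ⟨(s + d) / 2, (s - d) / 2, by omega, by omega⟩
      have e1 : (4 * y - (y + 3 * k)) / 3 = y - k := by omega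
      have e2 : (y + 3 * k + 2 * y) / 3 = y + k := by omega
      have e3 : 2 * (3 * w) / 3 = 2 * w := by omega
      have e4 : 2 * (y + k) - (y - k) = y + 3 * k := by ring
      have e5 : (y + k + (y - k)) / 2 = y := by omega
      have e6 : 3 * (2 * w) / 2 = 3 * w := by omega
      simp only [e1, e2, e3, e4, e5, e6, and_true]
      refine ⟨?_, ?_, ?_⟩
      · rw [hS, mem_ternaryRepSet_intCast]
        linarith
      · change 3 * w % 3 = 0
        omega
      · change (y + 3 * k - y) % 3 = 0
        omega
  have h2 : (S ∩ {v | v.2.2 % 3 = 0 ∧ (v.1 + v.2.1) % 3 = 0}).ncard =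
      (S ∩ {v | v.2.2 % 3 = 0 ∧ (v.1 - v.2.1) % 3 = 0}).ncard := by
    refine ncard_eq_of_inverse (fun v => (v.1, -v.2.1, v.2.2)) (fun v => (v.1, -v.2.1, v.2.2))
      ?_ ?_
    all_goals
      rintro ⟨x, y, z⟩ ⟨h, hz, hxy⟩
      rw [hS, mem_ternaryRepSet_intCast] at h
      refine ⟨⟨?_, hz, ?_⟩, by simp⟩
      · rw [hS, mem_ternaryRepSet_intCast]
        linarith
      · simpa [sub_eq_add_neg] using hxy
  have h4 : (S ∩ {v | v.2.1 % 3 = 0}).ncard = (S ∩ {v | v.2.2 % 3 = 0}).ncard := by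
    refine ncard_eq_of_inverse (fun v => (v.1, v.2.2, v.2.1)) (fun v => (v.1, v.2.2, v.2.1)) ?_ ?_
    all_goals
      rintro ⟨x, y, z⟩ ⟨h, hz⟩
      rw [hS, mem_ternaryRepSet_intCast] at h
      refine ⟨⟨?_, hz⟩, rfl⟩
      rw [hS, mem_ternaryRepSet_intCast]
      linarith
  have hu : S = (S ∩ {v | v.2.1 % 3 = 0}) ∪ (S ∩ {v | v.2.2 % 3 = 0}) := by
    ext ⟨x, y, z⟩
    simp only [Set.mem_union, Set.mem_inter_iff, Set.mem_ofPred_eq]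
    constructor
    · intro h
      have := hmod x y z h
      tauto
    · tauto
  have hv : S ∩ {v | v.2.2 % 3 = 0} = (S ∩ {v | v.2.2 % 3 = 0 ∧ (v.1 - v.2.1) % 3 = 0}) ∪
      (S ∩ {v | v.2.2 % 3 = 0 ∧ (v.1 + v.2.1) % 3 = 0}) := by
    ext ⟨x, y, z⟩
    simp only [Set.mem_union, Set.mem_inter_iff, Set.mem_ofPred_eq]
    constructor
    · rintro ⟨h, hz⟩
      have := hmod x y z h
      replace hz : z % 3 = 0 := hz
      have hx : x % 3 = 1 ∨ x % 3 = 2 := by omega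
      have hy : y % 3 = 1 ∨ y % 3 = 2 := by omega
      have : (x - y) % 3 = 0 ∨ (x + y) % 3 = 0 := by
        rcases hx with hx | hx <;> rcases hy with hy | hy <;> omega
      tauto
    · tauto
  have hsum : (S ∩ {v | v.2.2 % 3 = 0}).ncard = 2 * ternaryRep 1 2 6 0 0 0 N := by
    rw [hv, Set.ncard_union_eq ?_ (hfin.inter_of_left _) (hfin.inter_of_left _), h2, h1]
    · ring
    · rw [Set.disjoint_left]
      rintro ⟨x, y, z⟩ ⟨h, hz, ha⟩ ⟨-, -, hb⟩
      replace ha : (x - y) % 3 = 0 := ha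
      replace hb : (x + y) % 3 = 0 := hb
      have := hmod x y z h
      omega
  rw [ternaryRep, ← hS, hu, Set.ncard_union_eq ?_ (hfin.inter_of_left _) (hfin.inter_of_left _),
    h4, hsum]
  · ring
  · rw [Set.disjoint_left]
    rintro ⟨x, y, z⟩ ⟨h, ha⟩ ⟨-, hb⟩
    replace ha : y % 3 = 0 := ha
    replace hb : z % 3 = 0 := hb
    have := hmod x y z h
    omega

/-- When `9 ∤ M`, both sides vanish. -/
theorem ternaryRep_one_one_one_div_nine_eq {M : ℤ} (hM : M % 8 = 1) :
    ternaryRep 1 1 1 0 0 0 ((M : ℚ) / 3 ^ 2) = 3 * ternaryRep 1 8 8 0 0 0 ((M : ℚ) / 3 ^ 2) := by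
  by_cases h : 9 ∣ M
  · obtain ⟨m, rfl⟩ := h
    have e : ((9 * m : ℤ) : ℚ) / 3 ^ 2 = m := by
      push_cast
      ring
    rw [e]
    exact ternaryRep_one_one_one (by omega)
  · have hempty : ∀ a b c : ℤ, ternaryRep a b c 0 0 0 ((M : ℚ) / 3 ^ 2) = 0 := by
      intro a b c
      have : ternaryRepSet a b c 0 0 0 ((M : ℚ) / 3 ^ 2) = ∅ := by
        rw [Set.eq_empty_iff_forall_notMem]
        rintro ⟨x, y, z⟩ hv
        rw [mem_ternaryRepSet_div_nine] at hv
        exact h ⟨_, hv.symm⟩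
      rw [ternaryRep, this, Set.ncard_empty]
    rw [hempty, hempty]

theorem mainTheorem7 :
    (∀ M : ℤ, M ≡ 1 [ZMOD 8] → 3 ∣ M →
      3 * (ternaryRep 1 8 8 0 0 0 ((M : ℚ) / 3 ^ 2) : ℤ) =
        -(ternaryRep 1 6 6 0 0 0 M : ℤ) + 2 * (ternaryRep 2 3 6 0 0 0 M : ℤ)) ∧
    (∀ M : ℤ, (M ≡ 1 [ZMOD 4] ∨ M ≡ 2 [ZMOD 4]) → 3 ∣ M →
      (ternaryRep 1 1 1 0 0 0 ((M : ℚ) / 3 ^ 2) : ℤ) =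
        -(ternaryRep 1 6 6 0 0 0 M : ℤ) + 2 * (ternaryRep 2 3 6 0 0 0 M : ℤ)) ∧
    (∀ M : ℤ, M ≡ 1 [ZMOD 8] → 3 ∣ M → ¬ 3 ^ 2 ∣ M →
      ternaryRep 1 6 6 0 0 0 M = 2 * ternaryRep 2 3 6 0 0 0 M ∧
      ternaryRep 1 8 8 0 0 0 M = 2 * ternaryRep 1 6 6 0 0 0 M) := by
  have two : ∀ M : ℤ, (M ≡ 1 [ZMOD 4] ∨ M ≡ 2 [ZMOD 4]) → 3 ∣ M →
      (ternaryRep 1 1 1 0 0 0 ((M : ℚ) / 3 ^ 2) : ℤ) =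
        -(ternaryRep 1 6 6 0 0 0 M : ℤ) + 2 * (ternaryRep 2 3 6 0 0 0 M : ℤ) := by
    rintro M hM ⟨N, rfl⟩
    simp only [Int.ModEq] at hM
    have h := ternaryRep_relation_int (N := N) (by omega)
    rw [ternaryRep_one_one_one_div_nine, ternaryRep_one_six_six, ternaryRep_two_three_six]
    omega
  refine ⟨fun M hM h3 => ?_, two, ?_⟩
  · have hM' : M % 8 = 1 := hM
    have h := two M (Or.inl (by simp only [Int.ModEq]; omega)) h3
    rw [ternaryRep_one_one_one_div_nine_eq hM'] at h
    rw [← h]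
    push_cast
    rfl
  · rintro M hM ⟨N, rfl⟩ h9
    have hM' : 3 * N % 8 = 1 := hM
    have h := ternaryRep_relation_int (N := N) (by omega)
    -- as `3 ∤ N`, the form `(3, 3, 3)` does not represent `N`
    have h0 : ternaryRep 3 3 3 0 0 0 N = 0 := by
      rw [ternaryRep, Set.ncard_eq_zero (ternaryRepSet_diag_finite three_pos three_pos three_pos _),
        Set.eq_empty_iff_forall_notMem]
      rintro ⟨x, y, z⟩ hv
      rw [mem_ternaryRepSet_intCast] at hv
      exact h9 ⟨x ^ 2 + y ^ 2 + z ^ 2, by linarith⟩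
    have h188 := ternaryRep_one_eight_eight (N := N) (by omega) (by omega)
    rw [h188, ternaryRep_one_six_six, ternaryRep_two_three_six]
    omega
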